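/- Let $d\ge 0$, $l=(l_1,\dots,l_d)\in\mathbb N_0^d$, and let $\beta,r\in\mathbb R$ satisfy either (i) $\beta>-1$ and $r>0$, or (ii) $\beta<-|l|$ and $r<-|l|+1$. Here $|y|=\sum_i y_i$, $(a)_n=a(a+1)\cdots(a+n-1)$, $y^j=(y_j,\dots,y_d)$, $Y_j=(y_1,\dots,y_j)$, $|y^{d+1}|=|Y_0|=0$ (so $|X_{j-1}|=x_1+\dots+x_{j-1}$ and $|L_{j-1}|=l_1+\dots+l_{j-1}$), and $\nu\le l$ means $\nu_i\le l_i$ for all $i$. Let $V^d_l=\{x\in\mathbb N_0^d: x\le l\}$ and $$W(x)=\prod_{i=1}^d\frac{(-l_i)_{x_i}}{x_i!}\;\frac{(\beta+1)_{|x|}}{(-|l|-r+1)_{|x|}},\qquad x\in V^d_l .$$ Let $$D=\sum_{1\le i,j\le d}x_j\,(l_i+\delta_{i,j}r-x_i)\,\triangle_i\nabla_j+\sum_{i=1}^d\big((\beta+1)l_i-(\beta+r+1)x_i\big)\triangle_i,\qquad \lambda_n=-n(n+\beta+r),$$ where $\triangle_if(x)=f(x+e_i)-f(x)$ and $\nabla_jf(x)=f(x)-f(x-e_j)$.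 For $0\le n\le N$ let $$Q_n(x;\alpha,\alpha',N)={}_3F_2\!\left({-n,\;n+\alpha+\alpha'+1,\;-x\atop \alpha+1,\;-N};1\right)=\sum_{k=0}^n\frac{(-n)_k(n+\alpha+\alpha'+1)_k(-x)_k}{(\alpha+1)_k(-N)_k\,k!}$$ be the Hahn polynomials, and for $\nu\in\mathbb N_0^d$, $\nu\le l$, put $$\phi_\nu(x)=\prod_{j=1}^d(\alpha_{1,j}+1)_{\nu_j}\,Q_{\nu_j}(x_j;\alpha_{1,j},\alpha_{2,j},l_j),$$ $$\alpha_{1,j}=\beta+|\nu^{j+1}|+|X_{j-1}|,\qquad \alpha_{2,j}=|L_{j-1}|-|X_{j-1}|+|\nu^{j+1}|+r-1 .$$ Then for every $\nu\le l$ no $(\alpha_{1,j}+1)_{\nu_j}$ vanishes at a point of $V^d_l$, and $\phi_\nu$ is a polynomial in $x$ (that is, there is a polynomial in $\mathbb R[x_1,\dots,x_d]$, again denoted $\phi_\nu$, that agrees with the formula at every $x\in\mathbb R^d$ where no $(\alpha_{1,j}+1)_{\nu_j}$ vanishes) which satisfies $$D\phi_\nu=\lambda_{|\nu|}\phi_\nu\quad\text{on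 }\mathbb R^d .$$ Moreover, for all $\nu,\mu\le l$, $$\sum_{x\in V^d_l}\phi_\nu(x)\,\phi_\mu(x)\,W(x)=B_\nu\,\delta_{\nu,\mu},$$ $$B_\nu=\frac{(-1)^{|\nu|}(1+\beta)_{|\nu|}}{(r+|\nu|)_{|l|-|\nu|}}\prod_{j=1}^d\frac{\nu_j!\,(\beta+r+2|\nu^{j+1}|+\nu_j+|L_{j-1}|)_{l_j+1}}{(-l_j)_{\nu_j}\,(\beta+r+2|\nu^{j}|+|L_{j-1}|)} .$$ Here, should a factor $\beta+r+2|\nu^{j}|+|L_{j-1}|$ be zero, the quotient in $B_\nu$ is read after cancelling this factor, i.e. with $c_j=\beta+r+2|\nu^{j+1}|+\nu_j+|L_{j-1}|$, the expression $(c_j)_{l_j+1}/(c_j+\nu_j)$ is read as $(c_j)_{\nu_j}(c_j+\nu_j+1)_{l_j-\nu_j}$. -/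

import Mathlib

namespace HahnBox

noncomputable section

/-- The Pochhammer symbol `(a)_n = a (a + 1) ⋯ (a + n - 1)`. -/
def poch (a : ℝ) (n : ℕ) : ℝ := (ascPochhammer ℝ n).eval a

/-- The one-variable Hahn polynomial
`Q_n(x; a, b, N) = ₃F₂(-n, n + a + b + 1, -x; a + 1, -N; 1)`, for `n ≤ N`
(the hypergeometric series terminates at `k = n`). -/
def hahnQ (n : ℕ) (x a b : ℝ) (N : ℕ) : ℝ :=
  ∑ k ∈ Finset.range (n + 1),
    (poch (-(n : ℝ)) k * poch (n + a + b + 1) k * poch (-x) k) /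
      (poch (a + 1) k * poch (-(N : ℝ)) k * (k.factorial : ℝ))

variable {d : ℕ}

/-- `|y| = y_1 + ⋯ + y_d`. -/
def tot (y : Fin d → ℝ) : ℝ := ∑ i, y i

/-- `|Y_{j-1}| = y_1 + ⋯ + y_{j-1}`. -/
def before (y : Fin d → ℝ) (j : Fin d) : ℝ := ∑ i ∈ Finset.Iio j, y i

/-- `|y^{j+1}| = y_{j+1} + ⋯ + y_d`. -/
def after (y : Fin d → ℝ) (j : Fin d) : ℝ := ∑ i ∈ Finset.Ioi j, y i

/-- A vector of natural numbers, seen in `ℝ^d`. -/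
def toReal (m : Fin d → ℕ) : Fin d → ℝ := fun i => (m i : ℝ)

/-- The parallelepiped `V^d_l = {x ∈ ℕ₀^d : x_i ≤ l_i for all i}`. -/
def box (l : Fin d → ℕ) : Finset (Fin d → ℕ) := Finset.Iic l

/-- The weight `∏ (-l_i)_{x_i} / x_i! · (β + 1)_{|x|} / (-|l| - r + 1)_{|x|}`. -/
def weight (β r : ℝ) (l x : Fin d → ℕ) : ℝ :=
  (∏ i, poch (-(l i : ℝ)) (x i) / ((x i).factorial : ℝ)) *
    (poch (β + 1) (∑ i, x i) / poch (-tot (toReal l) - r + 1) (∑ i, x i))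

/-- The parameter `α_{1,j} = β + |ν^{j+1}| + |X_{j-1}|`. -/
def alpha1 (β : ℝ) (ν : Fin d → ℕ) (x : Fin d → ℝ) (j : Fin d) : ℝ :=
  β + after (toReal ν) j + before x j

/-- The parameter `α_{2,j} = |L_{j-1}| - |X_{j-1}| + |ν^{j+1}| + r - 1`. -/
def alpha2 (r : ℝ) (l ν : Fin d → ℕ) (x : Fin d → ℝ) (j : Fin d) : ℝ :=
  before (toReal l) j - before x j + after (toReal ν) j + r - 1

/-- The nested product
`φ_ν(x) = ∏_j (α_{1,j} + 1)_{ν_j} Q_{ν_j}(x_j; α_{1,j}, α_{2,j}, l_j)`. The formula divides by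
`(α_{1,j} + 1)_k` for `k ≤ ν_j`, so it is meaningful where `PhiDefined` holds. -/
def phi (β r : ℝ) (l ν : Fin d → ℕ) (x : Fin d → ℝ) : ℝ :=
  ∏ j, poch (alpha1 β ν x j + 1) (ν j) *
    hahnQ (ν j) (x j) (alpha1 β ν x j) (alpha2 r l ν x j) (l j)

/-- No denominator `(α_{1,j} + 1)_k`, `k ≤ ν_j`, in the formula for `φ_ν(x)` vanishes. -/
def PhiDefined (β : ℝ) (ν : Fin d → ℕ) (x : Fin d → ℝ) : Prop :=
  ∀ j, poch (alpha1 β ν x j + 1) (ν j) ≠ 0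

/-- The shift `(E_i f)(x) = f(x + e_i)`. -/
def shift (i : Fin d) (f : (Fin d → ℝ) → ℝ) (x : Fin d → ℝ) : ℝ := f (x + Pi.single i 1)

/-- The forward difference `(Δ_i f)(x) = f(x + e_i) - f(x)`. -/
def fwd (i : Fin d) (f : (Fin d → ℝ) → ℝ) (x : Fin d → ℝ) : ℝ := shift i f x - f x

/-- The backward difference `(∇_j f)(x) = f(x) - f(x - e_j)`. -/
def bwd (j : Fin d) (f : (Fin d → ℝ) → ℝ) (x : Fin d → ℝ) : ℝ := f x - f (x - Pi.single j 1)

/-- The difference operator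
`D = ∑_{i,j} x_j (l_i + δ_{ij} r - x_i) Δ_i ∇_j + ∑_i ((β + 1) l_i - (β + r + 1) x_i) Δ_i`. -/
def diffOp (β r : ℝ) (l : Fin d → ℕ) (f : (Fin d → ℝ) → ℝ) (x : Fin d → ℝ) : ℝ :=
  (∑ i, ∑ j, x j * ((l i : ℝ) + (if i = j then r else 0) - x i) * fwd i (bwd j f) x) +
    ∑ i, ((β + 1) * (l i : ℝ) - (β + r + 1) * x i) * fwd i f x

/-- The eigenvalue `λ_n = -n (n + β + r)`. -/
def eigenval (β r : ℝ) (n : ℕ) : ℝ := -(n : ℝ) * (n + β + r)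

/-- `c_j = β + r + 2|ν^{j+1}| + ν_j + |L_{j-1}|`. -/
def normC (β r : ℝ) (l ν : Fin d → ℕ) (j : Fin d) : ℝ :=
  β + r + 2 * after (toReal ν) j + (ν j : ℝ) + before (toReal l) j

/-- The denominator `β + r + 2|ν^j| + |L_{j-1}|`, where `|ν^j| = ν_j + |ν^{j+1}|`. -/
def normDen (β r : ℝ) (l ν : Fin d → ℕ) (j : Fin d) : ℝ :=
  β + r + 2 * ((ν j : ℝ) + after (toReal ν) j) + before (toReal l) j

/-- The norm
`B_ν = (-1)^{|ν|} (1+β)_{|ν|} / (r+|ν|)_{|l|-|ν|} ·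
  ∏_j ν_j! (c_j)_{l_j+1} / ((-l_j)_{ν_j} (β + r + 2|ν^j| + |L_{j-1}|))`,
for `ν ≤ l` and nonzero denominators. -/
def normB (β r : ℝ) (l ν : Fin d → ℕ) : ℝ :=
  ((-1) ^ (∑ i, ν i) * poch (1 + β) (∑ i, ν i) /
      poch (r + ∑ i, (ν i : ℝ)) ((∑ i, l i) - ∑ i, ν i)) *
    ∏ j, (((ν j).factorial : ℝ) * poch (normC β r l ν j) (l j + 1)) /
      (poch (-(l j : ℝ)) (ν j) * normDen β r l ν j)

/-- The same norm after cancelling `β + r + 2|ν^j| + |L_{j-1}| = c_j + ν_j`, which is one of the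
factors of `(c_j)_{l_j+1}`; the quotient is `(c_j)_{ν_j} (c_j + ν_j + 1)_{l_j - ν_j}`. -/
def normBCancelled (β r : ℝ) (l ν : Fin d → ℕ) : ℝ :=
  ((-1) ^ (∑ i, ν i) * poch (1 + β) (∑ i, ν i) /
      poch (r + ∑ i, (ν i : ℝ)) ((∑ i, l i) - ∑ i, ν i)) *
    ∏ j, (((ν j).factorial : ℝ) * (poch (normC β r l ν j) (ν j) *
        poch (normC β r l ν j + (ν j : ℝ) + 1) (l j - ν j))) /
      poch (-(l j : ℝ)) (ν j)

end

end HahnBox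

namespace HahnBox
noncomputable section

/-! ### Pochhammer symbols -/

/-! Both claims go by induction on `d`, splitting off the last variable, with `β` and `r` free.
Cancelling denominators replaces each factor of `φ_ν` by `hahnR`, a polynomial in the variable and
in `b = α_{1,j} + 1`. By `phiReg_snoc`, the product at `(y, t)` is the `d`-variable product for `(β
+ n, r + n)` at `y` times a Hahn factor that sees `y` only through `|y|`.

Difference equation: `diffOp_eq` writes `D` through raising, lowering and transfer operators. On a
separated function these reduce to the same operators in `y`. The induction hypothesis eliminates
the transfer term, and the coefficients of the raised, lowered and unshifted `y`-factor match by
`hahnR_succ_param`, `hahnR_pred_param` and `hahnR_difference`.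

Orthogonality: up to the constant `(r)_{|l|}` the weight is `weightReg`. For fixed `y` it is a Hahn
weight in `t`, so the sum over `t` is one-variable orthogonality. The `y`-dependent part of the
resulting norm turns the remaining weight into that for `(β + n, r + n)` (`sum_weightReg_snoc`), and
induction finishes.

These identities hold for all real `β`, `r`; the parameter conditions serve only to keep the
original denominators nonzero. -/

lemma poch_zero (a : ℝ) : poch a 0 = 1 := by simp [poch]

lemma poch_succ (a : ℝ) (n : ℕ) : poch a (n + 1) = poch a n * (a + n) := by
  simp [poch, ascPochhammer_succ_right]

lemma poch_succ_left (a : ℝ) (n : ℕ) : poch a (n + 1) = a * poch (a + 1) n := by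
  simp [poch, ascPochhammer_succ_left]

lemma poch_add (a : ℝ) (m n : ℕ) : poch a (m + n) = poch a m * poch (a + m) n := by
  induction n with
  | zero => simp [poch_zero]
  | succ n ih => rw [← add_assoc, poch_succ, poch_succ, ih]; push_cast; ring

lemma poch_reflect (a : ℝ) (n : ℕ) : poch a n = (-1) ^ n * poch (1 - a - n) n := by
  induction n generalizing a with
  | zero => simp [poch_zero]
  | succ n ih =>
    rw [poch_succ_left, ih, poch_succ]
    have : 1 - (a + 1) - (n : ℝ) = 1 - a - (n + 1 : ℕ) := by push_cast; ring
    rw [this]; push_cast; ring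

lemma poch_ne_zero {a : ℝ} {n : ℕ} (h : ∀ k < n, a + k ≠ 0) : poch a n ≠ 0 := by
  induction n with
  | zero => simp [poch_zero]
  | succ n ih =>
    rw [poch_succ]
    exact mul_ne_zero (ih fun k hk => h k (by omega)) (h n (by omega))

lemma poch_neg_natCast_ne_zero {N k : ℕ} (h : k ≤ N) : poch (-(N : ℝ)) k ≠ 0 := by
  refine poch_ne_zero fun i hi => ?_
  have : (i : ℝ) < N := by exact_mod_cast lt_of_lt_of_le hi h
  linarith

lemma poch_neg_natCast_eq_zero {n k : ℕ} (h : n < k) : poch (-(n : ℝ)) k = 0 := by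
  obtain ⟨j, rfl⟩ := Nat.exists_eq_add_of_lt h
  rw [show n + j + 1 = n + 1 + j by ring, poch_add, poch_succ]
  simp

/-- `(-N)_k = (-1)^k k! binom(N, k)`. -/
lemma poch_neg_natCast (N k : ℕ) :
    poch (-(N : ℝ)) k = (-1) ^ k * ((k.factorial : ℝ) * (N.choose k : ℝ)) := by
  induction k with
  | zero => simp [poch_zero]
  | succ k ih =>
    rw [poch_succ, ih]
    have h : ((N.choose (k + 1) : ℝ)) * (k + 1) = N.choose k * (N - k) := by
      rcases le_or_gt k N with hk | hk
      · have := Nat.choose_succ_right_eq N k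
        rw [← Nat.cast_sub hk]
        exact_mod_cast this
      · rw [Nat.choose_eq_zero_of_lt hk, Nat.choose_eq_zero_of_lt (by omega)]; simp
    rw [Nat.factorial_succ]; push_cast
    linear_combination (-1) ^ k * (k.factorial : ℝ) * h

/-- The Chu–Vandermonde identity in its binomial form. -/
lemma poch_add_arg (a b : ℝ) (n : ℕ) :
    poch (a + b) n =
      ∑ p ∈ Finset.HasAntidiagonal.antidiagonal n, (n.choose p.1 : ℝ) * (poch a p.1 * poch b p.2) := by
  induction n with
  | zero => simp [poch_zero]
  | succ n ih =>
    rw [Finset.sum_antidiagonal_choose_succ_mul (fun i j => poch a i * poch b j), poch_succ, ih,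
      Finset.sum_mul, ← Finset.sum_add_distrib]
    refine Finset.sum_congr rfl fun p hp => ?_
    have h : p.1 + p.2 = n := Finset.HasAntidiagonal.mem_antidiagonal.mp hp
    have h' : n.choose p.2 = n.choose p.1 := (Nat.choose_symm_of_eq_add (by omega))
    have h'' : (n : ℝ) = p.1 + p.2 := by exact_mod_cast h.symm
    rw [poch_succ, poch_succ, h']
    rw [show a + b + (n : ℝ) = (a + p.1) + (b + p.2) by rw [h'']; ring]
    ring

lemma poch_add_arg_range (a b : ℝ) (n : ℕ) :
    poch (a + b) n =
      ∑ k ∈ Finset.range (n + 1), (n.choose k : ℝ) * (poch a k * poch b (n - k)) := by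
  rw [poch_add_arg,
    Finset.Nat.sum_antidiagonal_eq_sum_range_succ (fun i j =>
      (n.choose i : ℝ) * (poch a i * poch b j))]

/-- The Chu–Vandermonde identity `₂F₁(-n, a; c; 1) = (c - a)_n / (c)_n`, without denominators. -/
lemma poch_sub_arg (c a : ℝ) (n : ℕ) :
    ∑ k ∈ Finset.range (n + 1),
      (poch (-(n : ℝ)) k / (k.factorial : ℝ)) * (poch a k * poch (c + k) (n - k)) =
        poch (c - a) n := by
  rw [poch_reflect (c - a) n, show 1 - (c - a) - (n : ℝ) = a + (1 - c - n) by ring,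
    poch_add_arg_range, Finset.mul_sum]
  refine Finset.sum_congr rfl fun k hk => ?_
  have hk : k ≤ n := by simpa [Nat.lt_succ_iff] using hk
  obtain ⟨j, rfl⟩ := Nat.exists_eq_add_of_le hk
  have hf : (k.factorial : ℝ) ≠ 0 := by positivity
  rw [poch_neg_natCast, poch_reflect (c + k), Nat.add_sub_cancel_left,
    show 1 - (c + (k : ℝ)) - (j : ℝ) = 1 - c - ((k + j : ℕ) : ℝ) by push_cast; ring, pow_add]
  field_simp

/-! ### Hahn polynomials without denominators depending on the first parameter -/

/-- The coefficient `(-n)_k (n + s)_k / ((-N)_k k!)`. -/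
def hahnCoeff (n : ℕ) (s : ℝ) (N k : ℕ) : ℝ :=
  (poch (-(n : ℝ)) k * poch (n + s) k) / (poch (-(N : ℝ)) k * (k.factorial : ℝ))

lemma hahnCoeff_succ {n N k : ℕ} (s : ℝ) (hk : k < n) (hn : n ≤ N) :
    hahnCoeff n s N (k + 1) * ((k + 1) * (k - N)) =
      (k - n) * (n + s + k) * hahnCoeff n s N k := by
  have h1 : poch (-(N : ℝ)) k ≠ 0 := poch_neg_natCast_ne_zero (by omega)
  have h2 : (-(N : ℝ) + k) ≠ 0 := by
    have : (k : ℝ) < N := by exact_mod_cast lt_of_lt_of_le hk hn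
    linarith
  have h3 : (k.factorial : ℝ) ≠ 0 := by positivity
  have h4 : (k + 1 : ℝ) ≠ 0 := by positivity
  rw [hahnCoeff, hahnCoeff, poch_succ, poch_succ, poch_succ, Nat.factorial_succ]
  push_cast
  rw [show (k : ℝ) - N = -N + k by ring, div_mul_eq_mul_div, ← mul_div_assoc,
    div_eq_div_iff (by positivity) (by positivity)]
  ring

/-- `(b)_n Q_n(x; b - 1, s - b, N)`, a polynomial in `x` and `b`. -/
def hahnR (n : ℕ) (x b s : ℝ) (N : ℕ) : ℝ :=
  ∑ k ∈ Finset.range (n + 1), hahnCoeff n s N k * poch (-x) k * poch (b + k) (n - k)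

lemma poch_mul_hahnQ (n : ℕ) (x a a' : ℝ) (N : ℕ) (h : poch (a + 1) n ≠ 0) :
    poch (a + 1) n * hahnQ n x a a' N = hahnR n x (a + 1) (a + a' + 1) N := by
  rw [hahnQ, hahnR, Finset.mul_sum]
  refine Finset.sum_congr rfl fun k hk => ?_
  have hk : k ≤ n := by simpa [Nat.lt_succ_iff] using hk
  obtain ⟨j, rfl⟩ := Nat.exists_eq_add_of_le hk
  rw [poch_add] at h ⊢
  have h1 := left_ne_zero_of_mul h
  rw [hahnCoeff, Nat.add_sub_cancel_left,
    show ((k + j : ℕ) : ℝ) + a + a' + 1 = ((k + j : ℕ) : ℝ) + (a + a' + 1) by ring]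
  field_simp

lemma mul_poch_one_sub (x : ℝ) (k : ℕ) : x * poch (1 - x) k = (x - k) * poch (-x) k := by
  have h := poch_succ_left (-x) k
  rw [poch_succ, show -x + 1 = 1 - x by ring] at h
  linear_combination h

lemma poch_neg_sub_poch (x : ℝ) (k : ℕ) :
    poch (-x) (k + 1) - poch (-(x + 1)) (k + 1) = (k + 1) * poch (-x) k := by
  rw [poch_succ, poch_succ_left, show -(x + 1) + 1 = -x by ring]; ring

/-- Holds term by term: `x (1 - x)_k = (x - k) (-x)_k` leaves the factor `b + k`, which turns `(b +
1 + k)_{n-k}` into `(b + n) (b + k)_{n-k}`. It undoes the change `b → b + 1` caused by raising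
`|y|`. -/
lemma hahnR_succ_param (n : ℕ) (x b s : ℝ) (N : ℕ) :
    (b + x) * hahnR n x (b + 1) s N - x * hahnR n (x - 1) (b + 1) s N =
      (b + n) * hahnR n x b s N := by
  simp only [hahnR, Finset.mul_sum]
  rw [← Finset.sum_sub_distrib]
  refine Finset.sum_congr rfl fun k hk => ?_
  have hk : k ≤ n := by simpa [Nat.lt_succ_iff] using hk
  obtain ⟨j, rfl⟩ := Nat.exists_eq_add_of_le hk
  rw [Nat.add_sub_cancel_left, show -(x - 1) = 1 - x by ring]
  have h1 := mul_poch_one_sub x k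
  have h2 : (b + k) * poch (b + 1 + k) j = (b + (k + j : ℕ)) * poch (b + k) j := by
    have h := poch_succ_left (b + k) j
    rw [poch_succ, show b + (k : ℝ) + 1 = b + 1 + k by ring] at h
    push_cast
    linear_combination -h
  linear_combination hahnCoeff (k + j) s N k * poch (-x) k * h2
    - hahnCoeff (k + j) s N k * poch (b + 1 + k) j * h1

/-- Counterpart for lowering `|y|`. It is not termwise: each `(-x)_{k+1}` also yields a multiple of
`(-x)_k`, which the coefficient recurrence `hahnCoeff_succ` folds into the term of index `k`. -/
lemma hahnR_pred_param {n N : ℕ} (hn : n ≤ N) (x b s : ℝ) :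
    (s + 1 - b + N - x) * hahnR n x (b - 1) s N - (N - x) * hahnR n (x + 1) (b - 1) s N =
      (s + 1 - b + n) * hahnR n x b s N := by
  have key : ∀ k : ℕ, (N - x) * (poch (-x) (k + 1) - poch (-(x + 1)) (k + 1)) =
      (k + 1) * poch (-x) (k + 1) - (k + 1) * (k - N) * poch (-x) k := by
    intro k
    rw [poch_neg_sub_poch, poch_succ]; ring
  have hL : (s + 1 - b + N - x) * hahnR n x (b - 1) s N - (N - x) * hahnR n (x + 1) (b - 1) s N =
      (∑ k ∈ Finset.range (n + 1), (s + 1 - b + k) *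
        (hahnCoeff n s N k * poch (-x) k * poch (b - 1 + k) (n - k))) -
      ∑ k ∈ Finset.range n, (hahnCoeff n s N (k + 1) * ((k + 1) * (k - N))) *
        (poch (-x) k * poch (b - 1 + (k + 1 : ℕ)) (n - (k + 1))) := by
    simp only [hahnR, Finset.mul_sum]
    rw [← Finset.sum_sub_distrib, Finset.sum_range_succ', Finset.sum_range_succ' (n := n),
      eq_sub_iff_add_eq, add_right_comm, ← Finset.sum_add_distrib]
    congr 1
    · refine Finset.sum_congr rfl fun k _ => ?_
      push_cast
      linear_combination hahnCoeff n s N (k + 1) * poch (b - 1 + (k + 1)) (n - (k + 1)) * key k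
    · simp [poch_zero]; ring
  rw [hL, hahnR, Finset.mul_sum, Finset.sum_range_succ, Finset.sum_range_succ (n := n),
    add_sub_right_comm, ← Finset.sum_sub_distrib]
  congr 1
  · refine Finset.sum_congr rfl fun k hk => ?_
    have hk : k < n := by simpa using hk
    rw [hahnCoeff_succ s hk hn]
    obtain ⟨j, rfl⟩ := Nat.exists_eq_add_of_lt hk
    rw [show k + j + 1 - k = j + 1 by omega, show k + j + 1 - (k + 1) = j by omega,
      poch_succ_left, poch_succ, show b - 1 + (k : ℝ) + 1 = b + k by ring,
      show b - 1 + ((k + 1 : ℕ) : ℝ) = b + k by push_cast; ring]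
    push_cast
    ring
  · simp [poch_zero]

/-- The difference equation of the Hahn polynomials. -/
lemma hahnR_difference {n N : ℕ} (hn : n ≤ N) (x b s : ℝ) :
    (b + x) * (N - x) * (hahnR n (x + 1) b s N - hahnR n x b s N) +
      (s + 1 - b + N - x) * x * (hahnR n (x - 1) b s N - hahnR n x b s N) =
        -(n * (n + s)) * hahnR n x b s N := by
  -- The operator is bidiagonal on the basis `(-x)_k`, with diagonal entry `-k (s + k)`. The
  -- recurrence adds `(k - n)(n + s + k)`, and the total is `-n (n + s)` for every `k`.
  have key : ∀ k : ℕ, (b + x) * (N - x) * (poch (-(x + 1)) (k + 1) - poch (-x) (k + 1)) +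
      (s + 1 - b + N - x) * x * (poch (-(x - 1)) (k + 1) - poch (-x) (k + 1)) =
      -((k + 1) * (s + (k + 1))) * poch (-x) (k + 1) +
        (k + 1) * (k - N) * (b + k) * poch (-x) k := by
    intro k
    have h1 := mul_poch_one_sub x (k + 1)
    have h2 := poch_neg_sub_poch x k
    have h3 := poch_succ (-x) k
    rw [show -(x - 1) = 1 - x by ring]
    push_cast at h1
    rw [h3] at h1 h2 ⊢
    linear_combination (s + 1 - b + N - x) * h1 - (b + x) * (N - x) * h2
  have hL : (b + x) * (N - x) * (hahnR n (x + 1) b s N - hahnR n x b s N) +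
      (s + 1 - b + N - x) * x * (hahnR n (x - 1) b s N - hahnR n x b s N) =
      (∑ k ∈ Finset.range (n + 1), -(k * (s + k)) *
        (hahnCoeff n s N k * poch (-x) k * poch (b + k) (n - k))) +
      ∑ k ∈ Finset.range n, (hahnCoeff n s N (k + 1) * ((k + 1) * (k - N))) *
        ((b + k) * poch (-x) k * poch (b + (k + 1 : ℕ)) (n - (k + 1))) := by
    simp only [hahnR]
    rw [← Finset.sum_sub_distrib, ← Finset.sum_sub_distrib, Finset.mul_sum, Finset.mul_sum,
      ← Finset.sum_add_distrib, Finset.sum_range_succ',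
      Finset.sum_range_succ' (n := n), add_right_comm, ← Finset.sum_add_distrib]
    congr 1
    · refine Finset.sum_congr rfl fun k _ => ?_
      push_cast
      linear_combination hahnCoeff n s N (k + 1) * poch (b + (k + 1)) (n - (k + 1)) * key k
    · simp [poch_zero]
  rw [hL, hahnR, Finset.mul_sum, Finset.sum_range_succ, Finset.sum_range_succ (n := n),
    add_right_comm, ← Finset.sum_add_distrib]
  congr 1
  · refine Finset.sum_congr rfl fun k hk => ?_
    have hk : k < n := by simpa using hk
    rw [hahnCoeff_succ s hk hn]
    obtain ⟨j, rfl⟩ := Nat.exists_eq_add_of_lt hk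
    rw [show k + j + 1 - k = j + 1 by omega, show k + j + 1 - (k + 1) = j by omega,
      poch_succ_left, show b + ((k + 1 : ℕ) : ℝ) = b + k + 1 by push_cast; ring]
    push_cast
    ring
  · ring

/-! ### Orthogonality in one variable -/

lemma choose_mul_poch_neg (N k y : ℕ) :
    (N.choose (k + y) : ℝ) * poch (-((k + y : ℕ) : ℝ)) k =
      poch (-(N : ℝ)) k * ((N - k).choose y : ℝ) := by
  rw [poch_neg_natCast, poch_neg_natCast]
  have h : N.choose (k + y) * (k + y).choose k = N.choose k * (N - k).choose y := by
    simpa using Nat.choose_mul (n := N) (Nat.le_add_right k y)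
  have h' : (N.choose (k + y) : ℝ) * (k + y).choose k = N.choose k * (N - k).choose y := by
    exact_mod_cast h
  linear_combination (-1) ^ k * (k.factorial : ℝ) * h'

/-- Terms with `x < k` vanish; after `x = k + y` the rest is a Vandermonde sum for `(b + k) + r`. -/
lemma sum_moment {N k : ℕ} (hk : k ≤ N) (b r : ℝ) :
    ∑ x ∈ Finset.range (N + 1), (N.choose x : ℝ) * (poch b x * poch r (N - x)) *
      poch (-(x : ℝ)) k = poch (-(N : ℝ)) k * poch b k * poch (b + k + r) (N - k) := by
  obtain ⟨M, rfl⟩ := Nat.exists_eq_add_of_le hk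
  rw [add_assoc, Finset.sum_range_add, Finset.sum_eq_zero, zero_add, Nat.add_sub_cancel_left,
    poch_add_arg_range (b + k) r, Finset.mul_sum]
  · refine Finset.sum_congr rfl fun y _ => ?_
    have h := choose_mul_poch_neg (k + M) k y
    rw [Nat.add_sub_cancel_left] at h
    rw [poch_add, show k + M - (k + y) = M - y by omega]
    linear_combination poch b k * poch (b + k) y * poch r (M - y) * h
  · intro x hx
    rw [poch_neg_natCast_eq_zero (by simpa using hx), mul_zero]

/-- Sums against the one-variable weight `binom(N, x) (b)_x (r)_{N-x}`. -/
def hahnSum (b r : ℝ) (N : ℕ) (f : ℝ → ℝ) : ℝ :=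
  ∑ x ∈ Finset.range (N + 1), (N.choose x : ℝ) * (poch b x * poch r (N - x)) * f x

/-- The test function `(r + N - x)_m` only shifts the weight from `r` to `r + m`, so `sum_moment`
applies, and the sum over `k` is Chu–Vandermonde. The factor `(m + 1 - n)_n` vanishes for `m < n`,
which is the source of orthogonality. -/
lemma hahnSum_hahnR_mul_poch {n N : ℕ} (hn : n ≤ N) (b r : ℝ) (m : ℕ) :
    hahnSum b r N (fun x => hahnR n x b (b + r - 1) N * poch (r + N - x) m) =
      poch r m * poch b n * (poch (m + 1 - n) n * poch (b + r + m + n) (N - n)) := by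
  have h1 : hahnSum b r N (fun x => hahnR n x b (b + r - 1) N * poch (r + N - x) m) =
      ∑ k ∈ Finset.range (n + 1), hahnCoeff n (b + r - 1) N k * poch (b + k) (n - k) * poch r m *
        ∑ x ∈ Finset.range (N + 1), (N.choose x : ℝ) * (poch b x * poch (r + m) (N - x)) *
          poch (-(x : ℝ)) k := by
    simp only [hahnSum, hahnR, Finset.mul_sum, Finset.sum_mul]
    rw [Finset.sum_comm]
    refine Finset.sum_congr rfl fun k _ => Finset.sum_congr rfl fun x hx => ?_
    have hx : x ≤ N := by simpa [Nat.lt_succ_iff] using hx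
    have h : poch r (N - x) * poch (r + N - x) m = poch r m * poch (r + m) (N - x) := by
      rw [← poch_add, add_comm m, poch_add, Nat.cast_sub hx, add_sub_assoc]
    linear_combination (N.choose x : ℝ) * poch b x * hahnCoeff n (b + r - 1) N k *
      poch (-(x : ℝ)) k * poch (b + k) (n - k) * h
  have h2 := poch_sub_arg (b + r + m) (n + (b + r - 1)) n
  rw [show b + r + m - (n + (b + r - 1)) = (m : ℝ) + 1 - n by ring] at h2
  rw [h1, ← h2, Finset.sum_mul, Finset.mul_sum]
  refine Finset.sum_congr rfl fun k hk => ?_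
  have hk : k ≤ n := by simpa [Nat.lt_succ_iff] using hk
  rw [sum_moment (hk.trans hn)]
  have hN : poch (-(N : ℝ)) k ≠ 0 := poch_neg_natCast_ne_zero (hk.trans hn)
  obtain ⟨j, rfl⟩ := Nat.exists_eq_add_of_le hk
  obtain ⟨M, rfl⟩ := Nat.exists_eq_add_of_le hn
  rw [show k + j + M - k = j + M by omega, Nat.add_sub_cancel_left, Nat.add_sub_cancel_left,
    poch_add _ j M, poch_add b k j, hahnCoeff,
    show b + k + (r + m) = b + r + m + (k : ℝ) by ring,
    show b + r + m + (k : ℝ) + j = b + r + m + ((k + j : ℕ) : ℝ) by push_cast; ring]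
  field_simp

lemma hahnSum_const_mul (b r : ℝ) (N : ℕ) (c : ℝ) (f : ℝ → ℝ) :
    hahnSum b r N (fun x => c * f x) = c * hahnSum b r N f := by
  simp only [hahnSum, Finset.mul_sum]
  exact Finset.sum_congr rfl fun x _ => by ring

lemma hahnSum_sum (b r : ℝ) (N : ℕ) {ι : Type*} (s : Finset ι) (f : ι → ℝ → ℝ) :
    hahnSum b r N (fun x => ∑ i ∈ s, f i x) = ∑ i ∈ s, hahnSum b r N (f i) := by
  simp only [hahnSum, Finset.mul_sum]
  exact Finset.sum_comm

lemma poch_one_sub_natCast {m n : ℕ} (h : m < n) : poch ((m : ℝ) + 1 - n) n = 0 := by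
  rw [poch_reflect, show 1 - ((m : ℝ) + 1 - n) - n = -(m : ℝ) by ring,
    poch_neg_natCast_eq_zero h, mul_zero]

lemma poch_one (n : ℕ) : poch 1 n = n.factorial := by
  simp [poch]

lemma hahnSum_hahnR_mul_poch_neg {n N : ℕ} (hn : n ≤ N) (b r : ℝ) {k : ℕ} (hk : k ≤ n) :
    hahnSum b r N (fun x => hahnR n x b (b + r - 1) N * poch (-x) k) =
      if k = n then poch r n * poch b n * (n.factorial * poch (b + r + 2 * n) (N - n)) else 0 := by
  have h1 : ∀ x : ℝ, hahnR n x b (b + r - 1) N * poch (-x) k =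
      ∑ m ∈ Finset.range (k + 1), ((k.choose m : ℝ) * poch (-(r + N)) (k - m)) *
        (hahnR n x b (b + r - 1) N * poch (r + N - x) m) := by
    intro x
    -- Change of basis from `(-x)_k` to `(r + N - x)_m` with `m ≤ k`; only `m = n` can contribute.
    rw [show -x = (r + N - x) + -(r + N) by ring, poch_add_arg_range, Finset.mul_sum]
    exact Finset.sum_congr rfl fun m _ => by ring
  simp only [h1]
  rw [hahnSum_sum]
  simp only [hahnSum_const_mul, hahnSum_hahnR_mul_poch hn]
  rw [Finset.sum_range_succ, Finset.sum_eq_zero, zero_add]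
  · split_ifs with h
    · subst h
      simp only [Nat.choose_self, Nat.sub_self, poch_zero, add_sub_cancel_left, poch_one]
      rw [show b + r + (k : ℝ) + k = b + r + 2 * k by ring]
      simp
    · rw [poch_one_sub_natCast (by omega)]; simp
  · intro m hm
    have : m < k := by simpa using hm
    rw [poch_one_sub_natCast (by omega)]; simp

/-- Expanding the factor of lower degree in `(-x)_k`, only its top coefficient can survive, and only
when `m = n`. -/
lemma hahnSum_hahnR_mul_hahnR_of_le {m n N : ℕ} (hn : n ≤ N) (hm : m ≤ n) (b r : ℝ) :
    hahnSum b r N (fun x => hahnR n x b (b + r - 1) N * hahnR m x b (b + r - 1) N) =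
      if m = n then (-1) ^ n * poch b n * poch r n * (n.factorial *
        (poch (b + r - 1 + n) n * poch (b + r + 2 * n) (N - n))) / poch (-(N : ℝ)) n
      else 0 := by
  have h1 : ∀ x : ℝ, hahnR n x b (b + r - 1) N * hahnR m x b (b + r - 1) N =
      ∑ k ∈ Finset.range (m + 1), (hahnCoeff m (b + r - 1) N k * poch (b + k) (m - k)) *
        (hahnR n x b (b + r - 1) N * poch (-x) k) := by
    intro x
    rw [hahnR.eq_def m, Finset.mul_sum]
    exact Finset.sum_congr rfl fun k _ => by ring
  simp only [h1]
  rw [hahnSum_sum]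
  simp only [hahnSum_const_mul]
  rw [Finset.sum_range_succ, Finset.sum_eq_zero, zero_add, hahnSum_hahnR_mul_poch_neg hn _ _ hm]
  · split_ifs with h
    · subst h
      have hf : (m.factorial : ℝ) ≠ 0 := by positivity
      have hN : poch (-(N : ℝ)) m ≠ 0 := poch_neg_natCast_ne_zero hn
      rw [hahnCoeff, poch_neg_natCast m m, Nat.sub_self, poch_zero, Nat.choose_self,
        show (m : ℝ) + (b + r - 1) = b + r - 1 + m by ring]
      field_simp
      simp
    · simp
  · intro k hk
    have : k < m := by simpa using hk
    rw [hahnSum_hahnR_mul_poch_neg hn _ _ (by omega), if_neg (by omega), mul_zero]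

/-- Orthogonality of the Hahn polynomials. -/
lemma hahnSum_hahnR_mul_hahnR {m n N : ℕ} (hn : n ≤ N) (hm : m ≤ N) (b r : ℝ) :
    hahnSum b r N (fun x => hahnR n x b (b + r - 1) N * hahnR m x b (b + r - 1) N) =
      if n = m then (-1) ^ n * poch b n * poch r n * (n.factorial *
        (poch (b + r - 1 + n) n * poch (b + r + 2 * n) (N - n))) / poch (-(N : ℝ)) n
      else 0 := by
  rcases le_total m n with h | h
  · rw [hahnSum_hahnR_mul_hahnR_of_le hn h]
    simp only [eq_comm]
  · simp only [mul_comm (hahnR n _ _ _ _)]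
    rw [hahnSum_hahnR_mul_hahnR_of_le hm h]
    split_ifs with hnm
    · rw [hnm]
    · rfl

/-! ### The nested products as polynomials -/

section
variable {d : ℕ}

/-- The nested product `φ_ν` with the denominators depending on `x` cancelled. -/
def phiReg (β r : ℝ) (l ν : Fin d → ℕ) (x : Fin d → ℝ) : ℝ :=
  ∏ j, hahnR (ν j) (x j) (alpha1 β ν x j + 1)
    (β + r + 2 * after (toReal ν) j + before (toReal l) j) (l j)

/-- The sum `α_{1,j} + α_{2,j} + 1` is free of `x`, so `x` enters the parameters of `hahnR` only
through `b`. -/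
lemma phi_eq_phiReg {β r : ℝ} {l ν : Fin d → ℕ} {x : Fin d → ℝ} (h : PhiDefined β ν x) :
    phi β r l ν x = phiReg β r l ν x := by
  refine Finset.prod_congr rfl fun j _ => ?_
  rw [poch_mul_hahnQ _ _ _ _ _ (h j)]
  congr 1
  simp only [alpha1, alpha2]; ring

/-- Functions given by a polynomial in several variables. -/
def IsPolyFun (f : (Fin d → ℝ) → ℝ) : Prop :=
  ∃ P : MvPolynomial (Fin d) ℝ, ∀ x, MvPolynomial.eval x P = f x

lemma IsPolyFun.const (c : ℝ) : IsPolyFun (fun _ : Fin d → ℝ => c) :=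
  ⟨MvPolynomial.C c, fun x => by simp⟩

lemma IsPolyFun.coord (i : Fin d) : IsPolyFun (fun x : Fin d → ℝ => x i) :=
  ⟨MvPolynomial.X i, fun x => by simp⟩

lemma IsPolyFun.add {f g : (Fin d → ℝ) → ℝ} (hf : IsPolyFun f) (hg : IsPolyFun g) :
    IsPolyFun (fun x => f x + g x) := by
  obtain ⟨P, hP⟩ := hf
  obtain ⟨Q, hQ⟩ := hg
  exact ⟨P + Q, fun x => by simp [hP, hQ]⟩

lemma IsPolyFun.mul {f g : (Fin d → ℝ) → ℝ} (hf : IsPolyFun f) (hg : IsPolyFun g) :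
    IsPolyFun (fun x => f x * g x) := by
  obtain ⟨P, hP⟩ := hf
  obtain ⟨Q, hQ⟩ := hg
  exact ⟨P * Q, fun x => by simp [hP, hQ]⟩

lemma IsPolyFun.sum {ι : Type*} {s : Finset ι} {f : ι → (Fin d → ℝ) → ℝ}
    (hf : ∀ i ∈ s, IsPolyFun (f i)) : IsPolyFun (fun x => ∑ i ∈ s, f i x) := by
  choose! P hP using hf
  exact ⟨∑ i ∈ s, P i, fun x => by
    rw [map_sum]; exact Finset.sum_congr rfl fun i hi => hP i hi x⟩

lemma IsPolyFun.prod {ι : Type*} {s : Finset ι} {f : ι → (Fin d → ℝ) → ℝ}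
    (hf : ∀ i ∈ s, IsPolyFun (f i)) : IsPolyFun (fun x => ∏ i ∈ s, f i x) := by
  choose! P hP using hf
  exact ⟨∏ i ∈ s, P i, fun x => by
    rw [map_prod]; exact Finset.prod_congr rfl fun i hi => hP i hi x⟩

lemma IsPolyFun.poch {f : (Fin d → ℝ) → ℝ} (hf : IsPolyFun f) (n : ℕ) :
    IsPolyFun (fun x => poch (f x) n) := by
  induction n with
  | zero => simpa only [poch_zero] using IsPolyFun.const 1
  | succ n ih => simpa only [poch_succ] using ih.mul (hf.add (.const n))

lemma IsPolyFun.hahnR {f g : (Fin d → ℝ) → ℝ} (hf : IsPolyFun f) (hg : IsPolyFun g) (n : ℕ)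
    (s : ℝ) (N : ℕ) : IsPolyFun (fun x => hahnR n (f x) (g x) s N) := by
  refine .sum fun k _ => .mul (.mul (.const _) (.poch ?_ k)) (.poch (hg.add (.const _)) _)
  simpa only [neg_one_mul] using (IsPolyFun.const (-1)).mul hf

lemma isPolyFun_phiReg (β r : ℝ) (l ν : Fin d → ℕ) : IsPolyFun (phiReg β r l ν) := by
  refine .prod fun j _ => .hahnR (.coord j) (.add (.add (.const _) ?_) (.const 1)) _ _ _
  exact .sum fun i _ => .coord i

/-! ### The difference operator in terms of raising and lowering operators -/

/-- `f ↦ ∑_i (l_i - x_i) f(x + e_i)`. -/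
def raise (l : Fin d → ℕ) (f : (Fin d → ℝ) → ℝ) (x : Fin d → ℝ) : ℝ :=
  ∑ i, ((l i : ℝ) - x i) * f (x + Pi.single i 1)

/-- `f ↦ ∑_j x_j f(x - e_j)`. -/
def lower (f : (Fin d → ℝ) → ℝ) (x : Fin d → ℝ) : ℝ :=
  ∑ j, x j * f (x - Pi.single j 1)

/-- `f ↦ ∑_{i,j} (l_i - x_i) x_j f(x + e_i - e_j)`. -/
def transfer (l : Fin d → ℕ) (f : (Fin d → ℝ) → ℝ) (x : Fin d → ℝ) : ℝ :=
  ∑ i, ∑ j, ((l i : ℝ) - x i) * x j * f (x + Pi.single i 1 - Pi.single j 1)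

/-- The diagonal `r`-terms `r x_i f(x + e_i)` cancel against the first-order part; the other double
sums, apart from `transfer`, factor through `|x|` and `|l| - |x|`. -/
lemma diffOp_eq (β r : ℝ) (l : Fin d → ℕ) (f : (Fin d → ℝ) → ℝ) (x : Fin d → ℝ) :
    diffOp β r l f x = (tot x + β + 1) * raise l f x +
      (tot (toReal l) + r - tot x) * lower f x - transfer l f x -
      ((β + 1 + tot x) * (tot (toReal l) - tot x) + r * tot x) * f x := by
  have h1 : ∀ i j, x j * ((l i : ℝ) + (if i = j then r else 0) - x i) * fwd i (bwd j f) x =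
      x j * (((l i : ℝ) - x i) * f (x + Pi.single i 1)) +
        ((l i : ℝ) - x i) * (x j * f (x - Pi.single j 1)) -
        ((l i : ℝ) - x i) * x j * f (x + Pi.single i 1 - Pi.single j 1) -
        ((l i : ℝ) - x i) * (x j * f x) +
        (if i = j then r * (x j * f (x + Pi.single j 1) + x j * f (x - Pi.single j 1) -
          2 * (x j * f x)) else 0) := by
    intro i j
    simp only [fwd, bwd, shift]
    split_ifs with h
    · subst h; rw [add_sub_cancel_right]; ring
    · ring
  have h2 : ∀ i, ((β + 1) * (l i : ℝ) - (β + r + 1) * x i) * fwd i f x =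
      (β + 1) * (((l i : ℝ) - x i) * f (x + Pi.single i 1)) - r * (x i * f (x + Pi.single i 1))
        - ((β + 1) * ((l i : ℝ) - x i) - r * x i) * f x := by
    intro i
    simp only [fwd, shift]; ring
  rw [diffOp]
  simp only [h1, h2, Finset.sum_add_distrib, Finset.sum_sub_distrib, ← Finset.mul_sum,
    ← Finset.sum_mul, Finset.sum_ite_eq, Finset.mem_univ, if_true]
  simp only [tot, raise, lower, transfer, toReal]
  ring

end

/-! ### Splitting off the last variable -/

section
variable {d : ℕ}

lemma tot_snoc (y : Fin d → ℝ) (t : ℝ) : tot (Fin.snoc y t : Fin (d + 1) → ℝ) = tot y + t := by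
  simp [tot, Fin.sum_univ_castSucc]

lemma before_eq_sum_ite (y : Fin d → ℝ) (j : Fin d) :
    before y j = ∑ i, if i < j then y i else 0 := by
  rw [before, ← Finset.sum_filter]
  congr 1; ext; simp

lemma after_eq_sum_ite (y : Fin d → ℝ) (j : Fin d) :
    after y j = ∑ i, if j < i then y i else 0 := by
  rw [after, ← Finset.sum_filter]
  congr 1; ext; simp

lemma before_snoc_castSucc (y : Fin d → ℝ) (t : ℝ) (j : Fin d) :
    before (Fin.snoc y t : Fin (d + 1) → ℝ) j.castSucc = before y j := by
  rw [before_eq_sum_ite, before_eq_sum_ite, Fin.sum_univ_castSucc]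
  simp [Fin.not_lt.mpr (Fin.le_last _)]

lemma before_snoc_last (y : Fin d → ℝ) (t : ℝ) :
    before (Fin.snoc y t : Fin (d + 1) → ℝ) (Fin.last d) = tot y := by
  rw [before_eq_sum_ite, Fin.sum_univ_castSucc]
  simp [tot, Fin.castSucc_lt_last]

lemma after_snoc_castSucc (y : Fin d → ℝ) (t : ℝ) (j : Fin d) :
    after (Fin.snoc y t : Fin (d + 1) → ℝ) j.castSucc = after y j + t := by
  rw [after_eq_sum_ite, after_eq_sum_ite, Fin.sum_univ_castSucc]
  simp [Fin.castSucc_lt_last]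

lemma after_last (y : Fin (d + 1) → ℝ) : after y (Fin.last d) = 0 := by
  rw [after]
  convert Finset.sum_empty
  ext i; simp [Fin.le_last]

lemma toReal_snoc (m : Fin d → ℕ) (n : ℕ) :
    toReal (Fin.snoc m n : Fin (d + 1) → ℕ) = Fin.snoc (toReal m) (n : ℝ) := by
  ext i
  refine Fin.lastCases ?_ (fun j => ?_) i <;> simp [toReal]

/-- The last index `n` occurs in every earlier `|ν^{j+1}|`: once in `α_{1,j}`, giving `β + n`, and
twice in the parameter sum, giving `(β + n) + (r + n)`. -/
lemma phiReg_snoc (β r : ℝ) (l ν : Fin d → ℕ) (N n : ℕ) (y : Fin d → ℝ) (t : ℝ) :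
    phiReg β r (Fin.snoc l N : Fin (d + 1) → ℕ) (Fin.snoc ν n) (Fin.snoc y t) =
      phiReg (β + n) (r + n) l ν y *
        hahnR n t (β + tot y + 1) (β + r + tot (toReal l)) N := by
  rw [phiReg, Fin.prod_univ_castSucc, phiReg]
  congr 1
  · refine Finset.prod_congr rfl fun j _ => ?_
    simp only [alpha1, toReal_snoc, before_snoc_castSucc, after_snoc_castSucc,
      Fin.snoc_castSucc]
    congr 1 <;> ring
  · simp only [alpha1, toReal_snoc, before_snoc_last, after_last, Fin.snoc_last]
    congr 1 <;> ring

lemma snoc_add_single_castSucc (y : Fin d → ℝ) (t : ℝ) (i : Fin d) :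
    (Fin.snoc y t : Fin (d + 1) → ℝ) + Pi.single i.castSucc 1 =
      Fin.snoc (y + Pi.single i 1) t := by
  ext j
  refine Fin.lastCases ?_ (fun j => ?_) j
  · simp [(Fin.castSucc_lt_last i).ne']
  · simp [Pi.single_apply]

lemma snoc_sub_single_castSucc (y : Fin d → ℝ) (t : ℝ) (i : Fin d) :
    (Fin.snoc y t : Fin (d + 1) → ℝ) - Pi.single i.castSucc 1 =
      Fin.snoc (y - Pi.single i 1) t := by
  ext j
  refine Fin.lastCases ?_ (fun j => ?_) j
  · simp [(Fin.castSucc_lt_last i).ne']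
  · simp [Pi.single_apply]

lemma snoc_add_single_last (y : Fin d → ℝ) (t : ℝ) :
    (Fin.snoc y t : Fin (d + 1) → ℝ) + Pi.single (Fin.last d) 1 = Fin.snoc y (t + 1) := by
  ext j
  refine Fin.lastCases ?_ (fun j => ?_) j
  · simp
  · simp [(Fin.castSucc_lt_last j).ne]

lemma snoc_sub_single_last (y : Fin d → ℝ) (t : ℝ) :
    (Fin.snoc y t : Fin (d + 1) → ℝ) - Pi.single (Fin.last d) 1 = Fin.snoc y (t - 1) := by
  ext j
  refine Fin.lastCases ?_ (fun j => ?_) j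
  · simp
  · simp [(Fin.castSucc_lt_last j).ne]

lemma tot_add_single (y : Fin d → ℝ) (i : Fin d) : tot (y + Pi.single i 1) = tot y + 1 := by
  simp [tot, Finset.sum_add_distrib]

lemma tot_sub_single (y : Fin d → ℝ) (i : Fin d) : tot (y - Pi.single i 1) = tot y - 1 := by
  simp [tot, Finset.sum_sub_distrib]

variable {f : (Fin (d + 1) → ℝ) → ℝ} {g : (Fin d → ℝ) → ℝ} {F : ℝ → ℝ → ℝ}

lemma raise_snoc (hf : ∀ y t, f (Fin.snoc y t) = g y * F (tot y) t) (l : Fin d → ℕ) (N : ℕ)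
    (y : Fin d → ℝ) (t : ℝ) :
    raise (Fin.snoc l N : Fin (d + 1) → ℕ) f (Fin.snoc y t) =
      raise l g y * F (tot y + 1) t + (N - t) * (g y * F (tot y) (t + 1)) := by
  simp only [raise, Fin.sum_univ_castSucc, snoc_add_single_castSucc, snoc_add_single_last, hf,
    tot_add_single, Fin.snoc_castSucc, Fin.snoc_last, Finset.sum_mul, mul_assoc]

lemma lower_snoc (hf : ∀ y t, f (Fin.snoc y t) = g y * F (tot y) t)
    (y : Fin d → ℝ) (t : ℝ) :
    lower f (Fin.snoc y t) =
      lower g y * F (tot y - 1) t + t * (g y * F (tot y) (t - 1)) := by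
  simp only [lower, Fin.sum_univ_castSucc, snoc_sub_single_castSucc, snoc_sub_single_last, hf,
    tot_sub_single, Fin.snoc_castSucc, Fin.snoc_last, Finset.sum_mul, mul_assoc]

/-- A move inside `y` preserves `|y|`, hence `F`; a move between `y` and `t` shifts the two
arguments of `F` oppositely. -/
lemma transfer_snoc (hf : ∀ y t, f (Fin.snoc y t) = g y * F (tot y) t) (l : Fin d → ℕ) (N : ℕ)
    (y : Fin d → ℝ) (t : ℝ) :
    transfer (Fin.snoc l N : Fin (d + 1) → ℕ) f (Fin.snoc y t) =
      transfer l g y * F (tot y) t + t * raise l g y * F (tot y + 1) (t - 1) +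
        (N - t) * lower g y * F (tot y - 1) (t + 1) + (N - t) * t * (g y * F (tot y) t) := by
  simp only [transfer, Fin.sum_univ_castSucc, snoc_add_single_castSucc, snoc_add_single_last,
    snoc_sub_single_castSucc, snoc_sub_single_last, hf, tot_add_single, tot_sub_single,
    Fin.snoc_castSucc, Fin.snoc_last, Finset.sum_add_distrib, add_sub_cancel_right]
  have h1 : ∑ i, ((l i : ℝ) - y i) * t * (g (y + Pi.single i 1) * F (tot y + 1) (t - 1)) =
      t * raise l g y * F (tot y + 1) (t - 1) := by
    simp only [raise, Finset.mul_sum, Finset.sum_mul]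
    exact Finset.sum_congr rfl fun i _ => by ring
  have h2 : ∑ j, ((N : ℝ) - t) * y j * (g (y - Pi.single j 1) * F (tot y - 1) (t + 1)) =
      (N - t) * lower g y * F (tot y - 1) (t + 1) := by
    simp only [lower, Finset.mul_sum, Finset.sum_mul]
    exact Finset.sum_congr rfl fun i _ => by ring
  rw [h1, h2]
  simp only [Finset.sum_mul, ← mul_assoc]
  ring

end

/-- The polynomials `φ_ν` are eigenfunctions of the difference operator. -/
theorem diffOp_phiReg (β r : ℝ) : ∀ {d : ℕ} (l ν : Fin d → ℕ), ν ≤ l → ∀ x : Fin d → ℝ,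
    diffOp β r l (phiReg β r l ν) x = eigenval β r (∑ i, ν i) * phiReg β r l ν x := by
  intro d
  induction d generalizing β r with
  | zero => intro l ν _ x; simp [diffOp, eigenval]
  | succ d ih =>
    intro l ν hν x
    induction l using Fin.snocCases with | _ l N
    induction ν using Fin.snocCases with | _ ν n
    induction x using Fin.snocCases with | _ y t
    have hn : n ≤ N := by simpa using hν (Fin.last d)
    have hν' : ν ≤ l := fun i => by simpa using hν i.castSucc
    have IH := ih (β + n) (r + n) l ν hν' y
    have hf := phiReg_snoc β r l ν N n
    rw [diffOp_eq] at IH ⊢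
    rw [raise_snoc (F := fun h t => hahnR n t (β + h + 1) (β + r + tot (toReal l)) N) hf,
      lower_snoc (F := fun h t => hahnR n t (β + h + 1) (β + r + tot (toReal l)) N) hf,
      transfer_snoc (F := fun h t => hahnR n t (β + h + 1) (β + r + tot (toReal l)) N) hf, hf,
      toReal_snoc, tot_snoc, tot_snoc]
    have e1 := hahnR_succ_param n t (β + tot y + 1) (β + r + tot (toReal l)) N
    have e2 := hahnR_pred_param hn t (β + tot y + 1) (β + r + tot (toReal l))
    have e3 := hahnR_difference hn t (β + tot y + 1) (β + r + tot (toReal l))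
    rw [show β + tot y + 1 + 1 = β + (tot y + 1) + 1 by ring] at e1
    rw [show β + tot y + 1 - 1 = β + (tot y - 1) + 1 by ring] at e2
    simp only [eigenval, Fin.sum_univ_castSucc, Fin.snoc_castSucc, Fin.snoc_last] at IH ⊢
    push_cast at IH ⊢
    -- With `b = β + |y| + 1` and `s = β + r + |l|`, the factors `b + n` and `s + 1 - b + n` in
    -- `e1`, `e2` are the raising and lowering coefficients of the operator for `(β + n, r + n)`.
    linear_combination hahnR n t (β + tot y + 1) (β + r + tot (toReal l)) N * IH +
      raise l (phiReg (β + n) (r + n) l ν) y * e1 + lower (phiReg (β + n) (r + n) l ν) y * e2 +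
      phiReg (β + n) (r + n) l ν y * e3

/-! ### Orthogonality in several variables -/

section
variable {d : ℕ}

lemma sum_box_snoc (l : Fin d → ℕ) (N : ℕ) (f : (Fin (d + 1) → ℕ) → ℝ) :
    ∑ x ∈ box (Fin.snoc l N : Fin (d + 1) → ℕ), f x =
      ∑ y ∈ box l, ∑ t ∈ Finset.range (N + 1), f (Fin.snoc y t) := by
  rw [← Finset.sum_product']
  refine Finset.sum_nbij' (fun x => (Fin.init x, x (Fin.last d)))
    (fun p => Fin.snoc p.1 p.2) ?_ ?_ ?_ ?_ ?_
  · intro x hx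
    have hx : x ≤ Fin.snoc l N := by simpa [box] using hx
    simp only [Finset.mem_product, box, Finset.mem_Iic, Finset.mem_range, Nat.lt_succ_iff]
    exact ⟨fun i => by simpa [Fin.init] using hx i.castSucc, by simpa using hx (Fin.last d)⟩
  · intro p hp
    simp only [Finset.mem_product, box, Finset.mem_Iic, Finset.mem_range, Nat.lt_succ_iff] at hp ⊢
    intro i
    refine Fin.lastCases ?_ (fun j => ?_) i
    · simpa using hp.2
    · simpa using hp.1 j
  · intro x _; simp
  · intro p _; simp
  · intro x _; simp

/-- The norm of `φ_ν` for the weight `∏ binom(l_i, x_i) (β + 1)_{|x|} (r)_{|l| - |x|}`. -/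
def normReg (β r : ℝ) (l ν : Fin d → ℕ) : ℝ :=
  (-1) ^ (∑ i, ν i) * (poch (β + 1) (∑ i, ν i) * poch r (∑ i, ν i)) *
    ∏ j, (((ν j).factorial : ℝ) * (poch (normC β r l ν j) (ν j) *
        poch (normC β r l ν j + (ν j : ℝ) + 1) (l j - ν j))) /
      poch (-(l j : ℝ)) (ν j)

lemma normReg_snoc (β r : ℝ) (l ν : Fin d → ℕ) (N n : ℕ) :
    normReg β r (Fin.snoc l N : Fin (d + 1) → ℕ) (Fin.snoc ν n) =
      ((-1) ^ n * (poch (β + 1) n * poch r n) * (n.factorial *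
        (poch (β + r + tot (toReal l) + n) n *
          poch (β + r + tot (toReal l) + 1 + 2 * n) (N - n))) / poch (-(N : ℝ)) n) *
        normReg (β + n) (r + n) l ν := by
  have h1 : ∀ j, normC β r (Fin.snoc l N : Fin (d + 1) → ℕ) (Fin.snoc ν n) j.castSucc =
      normC (β + n) (r + n) l ν j := by
    intro j
    simp only [normC, toReal_snoc, after_snoc_castSucc, before_snoc_castSucc, Fin.snoc_castSucc]
    ring
  have h2 : normC β r (Fin.snoc l N : Fin (d + 1) → ℕ) (Fin.snoc ν n) (Fin.last d) =
      β + r + tot (toReal l) + n := by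
    simp only [normC, toReal_snoc, after_last, before_snoc_last, Fin.snoc_last]
    ring
  simp only [normReg, Fin.prod_univ_castSucc, Fin.sum_univ_castSucc, Fin.snoc_castSucc,
    Fin.snoc_last, h1, h2]
  rw [add_comm (∑ i, ν i) n, poch_add, poch_add, pow_add,
    show β + (n : ℝ) + 1 = β + 1 + n by ring,
    show β + r + tot (toReal l) + (n : ℝ) + n + 1 = β + r + tot (toReal l) + 1 + 2 * n by ring]
  ring

lemma tot_toReal (x : Fin d → ℕ) : tot (toReal x) = ((∑ i, x i : ℕ) : ℝ) := by
  simp [tot, toReal]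

/-- The weight `∏ binom(l_i, x_i) (β + 1)_{|x|} (r)_{|l| - |x|}`. -/
def weightReg (β r : ℝ) (l x : Fin d → ℕ) : ℝ :=
  (∏ i, ((l i).choose (x i) : ℝ)) *
    (poch (β + 1) (∑ i, x i) * poch r (∑ i, l i - ∑ i, x i))

/-- For fixed `y` the weight in `t` is the Hahn weight with parameters `β + |y| + 1` and `r + |l| -
|y|`. -/
lemma sum_weightReg_snoc (β r : ℝ) {l y : Fin d → ℕ} (hy : y ≤ l) {N n m : ℕ} (hn : n ≤ N)
    (hm : m ≤ N) :
    ∑ t ∈ Finset.range (N + 1),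
      hahnR n t (β + tot (toReal y) + 1) (β + r + tot (toReal l)) N *
        hahnR m t (β + tot (toReal y) + 1) (β + r + tot (toReal l)) N *
        weightReg β r (Fin.snoc l N : Fin (d + 1) → ℕ) (Fin.snoc y t) =
      if n = m then
        ((-1) ^ n * (poch (β + 1) n * poch r n) * (n.factorial *
          (poch (β + r + tot (toReal l) + n) n *
            poch (β + r + tot (toReal l) + 1 + 2 * n) (N - n))) / poch (-(N : ℝ)) n) *
          weightReg (β + n) (r + n) l y
      else 0 := by
  have hyl : ∑ i, y i ≤ ∑ i, l i := Finset.sum_le_sum fun i _ => hy i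
  have h := hahnSum_hahnR_mul_hahnR hn hm (β + tot (toReal y) + 1)
    (r + (tot (toReal l) - tot (toReal y)))
  rw [show β + tot (toReal y) + 1 + (r + (tot (toReal l) - tot (toReal y))) =
    β + r + tot (toReal l) + 1 by ring, add_sub_cancel_right] at h
  have hw : ∀ t ∈ Finset.range (N + 1),
      weightReg β r (Fin.snoc l N : Fin (d + 1) → ℕ) (Fin.snoc y t) = weightReg β r l y *
        ((N.choose t : ℝ) * (poch (β + tot (toReal y) + 1) t *
          poch (r + (tot (toReal l) - tot (toReal y))) (N - t))) := by
    intro t ht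
    have ht : t ≤ N := by simpa [Nat.lt_succ_iff] using ht
    simp only [weightReg, Fin.prod_univ_castSucc, Fin.sum_univ_castSucc, Fin.snoc_castSucc,
      Fin.snoc_last]
    rw [show ∑ i, l i + N - (∑ i, y i + t) = (∑ i, l i - ∑ i, y i) + (N - t) by omega,
      poch_add, poch_add, Nat.cast_sub hyl, tot_toReal, tot_toReal,
      show β + ((∑ i, y i : ℕ) : ℝ) + 1 = β + 1 + ((∑ i, y i : ℕ) : ℝ) by ring]
    ring
  have hS : ∑ t ∈ Finset.range (N + 1),
      hahnR n t (β + tot (toReal y) + 1) (β + r + tot (toReal l)) N *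
        hahnR m t (β + tot (toReal y) + 1) (β + r + tot (toReal l)) N *
        weightReg β r (Fin.snoc l N : Fin (d + 1) → ℕ) (Fin.snoc y t) =
      weightReg β r l y * hahnSum (β + tot (toReal y) + 1)
        (r + (tot (toReal l) - tot (toReal y))) N (fun t =>
          hahnR n t (β + tot (toReal y) + 1) (β + r + tot (toReal l)) N *
          hahnR m t (β + tot (toReal y) + 1) (β + r + tot (toReal l)) N) := by
    rw [hahnSum, Finset.mul_sum]
    refine Finset.sum_congr rfl fun t ht => ?_
    rw [hw t ht]; ring
  rw [hS, h]
  split_ifs with hnm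
  -- Splitting `(β + 1)_{|y| + n}` in both orders moves the `y`-dependence of the norm into the
  -- weight for `β + n`; `a2` does the same for `r`.
  · have a1 : poch (β + 1) (∑ i, y i) * poch (β + tot (toReal y) + 1) n =
        poch (β + 1) n * poch (β + n + 1) (∑ i, y i) := by
      rw [tot_toReal, add_right_comm, ← poch_add, add_comm (∑ i, y i), poch_add, add_right_comm]
    have a2 : poch r (∑ i, l i - ∑ i, y i) * poch (r + (tot (toReal l) - tot (toReal y))) n =
        poch r n * poch (r + n) (∑ i, l i - ∑ i, y i) := by
      rw [tot_toReal, tot_toReal, ← Nat.cast_sub hyl, ← poch_add, add_comm _ n, poch_add]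
    simp only [weightReg]
    linear_combination ((-1) ^ n * (n.factorial * (poch (β + r + tot (toReal l) + n) n *
      poch (β + r + tot (toReal l) + 1 + 2 * n) (N - n))) / poch (-(N : ℝ)) n) *
      (∏ i, ((l i).choose (y i) : ℝ)) * (poch r (∑ i, l i - ∑ i, y i) *
        poch (r + (tot (toReal l) - tot (toReal y))) n * a1 +
        poch (β + 1) n * poch (β + n + 1) (∑ i, y i) * a2)
  · rw [mul_zero]

end

/-- The inner sum forces `n = m`; only then do both `y`-factors belong to the same shifted family,
as the induction hypothesis requires. -/
theorem sum_phiReg_mul_phiReg (β r : ℝ) : ∀ {d : ℕ} (l ν μ : Fin d → ℕ), ν ≤ l → μ ≤ l →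
    ∑ x ∈ box l, phiReg β r l ν (toReal x) * phiReg β r l μ (toReal x) * weightReg β r l x =
      if ν = μ then normReg β r l ν else 0 := by
  intro d
  induction d generalizing β r with
  | zero =>
    intro l ν μ _ _
    have hb : box l = {l} := by
      ext x; simp [box, Subsingleton.elim x l]
    rw [hb, Finset.sum_singleton, if_pos (Subsingleton.elim _ _)]
    simp [phiReg, weightReg, normReg, poch_zero]
  | succ d ih =>
    intro l ν μ hν hμ
    induction l using Fin.snocCases with | _ l N
    induction ν using Fin.snocCases with | _ ν n
    induction μ using Fin.snocCases with | _ μ m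
    have hn : n ≤ N := by simpa using hν (Fin.last d)
    have hν' : ν ≤ l := fun i => by simpa using hν i.castSucc
    have hm : m ≤ N := by simpa using hμ (Fin.last d)
    have hμ' : μ ≤ l := fun i => by simpa using hμ i.castSucc
    rw [sum_box_snoc]
    have h1 : ∀ y ∈ box l, (∑ t ∈ Finset.range (N + 1),
        phiReg β r (Fin.snoc l N : Fin (d + 1) → ℕ) (Fin.snoc ν n)
            (toReal (Fin.snoc y t : Fin (d + 1) → ℕ)) *
          phiReg β r (Fin.snoc l N : Fin (d + 1) → ℕ) (Fin.snoc μ m)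
            (toReal (Fin.snoc y t : Fin (d + 1) → ℕ)) *
          weightReg β r (Fin.snoc l N : Fin (d + 1) → ℕ) (Fin.snoc y t)) =
        phiReg (β + n) (r + n) l ν (toReal y) * phiReg (β + m) (r + m) l μ (toReal y) *
          if n = m then
            ((-1) ^ n * (poch (β + 1) n * poch r n) * (n.factorial *
              (poch (β + r + tot (toReal l) + n) n *
                poch (β + r + tot (toReal l) + 1 + 2 * n) (N - n))) / poch (-(N : ℝ)) n) *
              weightReg (β + n) (r + n) l y
          else 0 := by
      intro y hy
      have hy : y ≤ l := by simpa [box] using hy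
      rw [← sum_weightReg_snoc β r hy hn hm, Finset.mul_sum]
      refine Finset.sum_congr rfl fun t _ => ?_
      rw [toReal_snoc, phiReg_snoc, phiReg_snoc]; ring
    rw [Finset.sum_congr rfl h1]
    by_cases hnm : n = m
    · subst hnm
      have h2 := ih (β + n) (r + n) l ν μ hν' hμ'
      simp only [if_true]
      have h3 : (if (Fin.snoc ν n : Fin (d + 1) → ℕ) = Fin.snoc μ n then
          normReg β r (Fin.snoc l N : Fin (d + 1) → ℕ) (Fin.snoc ν n) else 0) =
          ((-1) ^ n * (poch (β + 1) n * poch r n) * (n.factorial *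
              (poch (β + r + tot (toReal l) + n) n *
                poch (β + r + tot (toReal l) + 1 + 2 * n) (N - n))) / poch (-(N : ℝ)) n) *
            if ν = μ then normReg (β + n) (r + n) l ν else 0 := by
        rw [normReg_snoc, mul_ite, mul_zero]
        simp only [Fin.snoc_inj, and_true]
      rw [h3, ← h2, Finset.mul_sum]
      exact Finset.sum_congr rfl fun y _ => by ring
    · rw [if_neg (fun h => hnm (Fin.snoc_inj.mp h).2)]
      simp [hnm]

/-! ### Return to the stated weight, norm and denominators -/

section
variable {d : ℕ}

/-- The condition on the parameters under which the weight has constant sign. -/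
def Admissible (β r : ℝ) (L : ℕ) : Prop :=
  (-1 < β ∧ 0 < r) ∨ (β < -(L : ℝ) ∧ r < -(L : ℝ) + 1)

lemma Admissible.poch_r_ne_zero {β r : ℝ} {L : ℕ} (h : Admissible β r L) : poch r L ≠ 0 := by
  refine poch_ne_zero fun k hk => ?_
  rcases h with ⟨_, h⟩ | ⟨_, h⟩
  · positivity
  · have : (k : ℝ) + 1 ≤ L := by exact_mod_cast hk
    linarith

/-- Reflection turns the denominator into `(-1)^{|x|} (r + |l| - |x|)_{|x|}`, which completes
`(r)_{|l|-|x|}` to `(r)_{|l|}`; the sign cancels those of the `(-l_i)_{x_i}`. -/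
lemma weight_eq {β r : ℝ} {l x : Fin d → ℕ} (h : poch r (∑ i, l i) ≠ 0) (hx : x ≤ l) :
    weight β r l x = weightReg β r l x / poch r (∑ i, l i) := by
  have hxl : ∑ i, x i ≤ ∑ i, l i := Finset.sum_le_sum fun i _ => hx i
  have h1 : ∏ i, poch (-(l i : ℝ)) (x i) / ((x i).factorial : ℝ) =
      (-1) ^ (∑ i, x i) * ∏ i, ((l i).choose (x i) : ℝ) := by
    rw [← Finset.prod_pow_eq_pow_sum, ← Finset.prod_mul_distrib]
    refine Finset.prod_congr rfl fun i _ => ?_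
    have : ((x i).factorial : ℝ) ≠ 0 := by positivity
    rw [poch_neg_natCast]
    field_simp
  rw [weight, weightReg, h1, poch_reflect (-tot (toReal l) - r + 1), tot_toReal]
  obtain ⟨j, hj⟩ := Nat.exists_eq_add_of_le' hxl
  rw [hj] at h ⊢
  rw [poch_add] at h ⊢
  have h2 := left_ne_zero_of_mul h
  have h3 := right_ne_zero_of_mul h
  rw [Nat.add_sub_cancel, show 1 - (-((j + ∑ i, x i : ℕ) : ℝ) - r + 1) - ((∑ i, x i : ℕ) : ℝ) =
    r + j by push_cast; ring]
  field_simp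

lemma normBCancelled_eq {β r : ℝ} {l ν : Fin d → ℕ} (h : poch r (∑ i, l i) ≠ 0) (hν : ν ≤ l) :
    normBCancelled β r l ν = normReg β r l ν / poch r (∑ i, l i) := by
  have hνl : ∑ i, ν i ≤ ∑ i, l i := Finset.sum_le_sum fun i _ => hν i
  rw [normBCancelled, normReg]
  obtain ⟨j, hj⟩ := Nat.exists_eq_add_of_le hνl
  rw [hj] at h ⊢
  rw [poch_add] at h ⊢
  have h2 := left_ne_zero_of_mul h
  have h3 := right_ne_zero_of_mul h
  rw [Nat.add_sub_cancel_left, ← Nat.cast_sum, add_comm 1 β]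
  field_simp

lemma normBCancelled_eq_normB {β r : ℝ} {l ν : Fin d → ℕ} (hν : ν ≤ l)
    (h : ∀ j, normDen β r l ν j ≠ 0) : normBCancelled β r l ν = normB β r l ν := by
  rw [normBCancelled, normB]
  congr 1
  refine Finset.prod_congr rfl fun j _ => ?_
  have hj := h j
  have h1 : poch (-(l j : ℝ)) (ν j) ≠ 0 := poch_neg_natCast_ne_zero (hν j)
  have h2 : normDen β r l ν j = normC β r l ν j + ν j := by rw [normDen, normC]; ring
  rw [show l j + 1 = ν j + 1 + (l j - ν j) by have : ν j ≤ l j := hν j; omega, poch_add, poch_succ, h2]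
  rw [h2] at hj
  push_cast
  rw [← add_assoc]
  field_simp

lemma Admissible.phiDefined {β r : ℝ} {l ν x : Fin d → ℕ} (h : Admissible β r (∑ i, l i))
    (hν : ν ≤ l) (hx : x ≤ l) : PhiDefined β ν (toReal x) := by
  intro j
  have h1 : 0 ≤ after (toReal ν) j := Finset.sum_nonneg fun i _ => Nat.cast_nonneg _
  have h2 : 0 ≤ before (toReal x) j := Finset.sum_nonneg fun i _ => Nat.cast_nonneg _
  refine poch_ne_zero fun k hk => ?_
  rw [alpha1]
  rcases h with ⟨h, _⟩ | ⟨h, _⟩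
  · have : (0 : ℝ) ≤ k := Nat.cast_nonneg _
    linarith
  -- Here every factor is negative: `|ν^{j+1}| + |X_{j-1}| + k + 1 ≤ |l| < -β`.
  · have h3 : after (toReal ν) j ≤ after (toReal l) j :=
      Finset.sum_le_sum fun i _ => Nat.cast_le.mpr (hν i)
    have h4 : before (toReal x) j ≤ before (toReal l) j :=
      Finset.sum_le_sum fun i _ => Nat.cast_le.mpr (hx i)
    have h5 : (k : ℝ) + 1 ≤ l j := by exact_mod_cast lt_of_lt_of_le hk (hν j)
    have h6 : before (toReal l) j + l j + after (toReal l) j = ((∑ i, l i : ℕ) : ℝ) := by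
      rw [← tot_toReal, before, after, tot, ← Finset.sum_erase_add _ _ (Finset.mem_univ j),
        show Finset.univ.erase j = Finset.Iio j ∪ Finset.Ioi j by ext i; simp,
        Finset.sum_union]
      · simp only [toReal]; ring
      · rw [Finset.disjoint_left]
        intro i hi hi'
        simp only [Finset.mem_Iio, Finset.mem_Ioi] at hi hi'
        exact lt_asymm hi hi'
    linarith

end

end
end HahnBox

theorem theorem5p3 (d : ℕ) (l : Fin d → ℕ) (β r : ℝ)
    (hβr : (-1 < β ∧ 0 < r) ∨
      (β < -(∑ i, (l i : ℝ)) ∧ r < -(∑ i, (l i : ℝ)) + 1)) :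
    -- the formula for `φ_ν` makes sense on `V^d_l`, it defines a polynomial, and that polynomial
    -- satisfies the difference equation on all of `ℝ^d`
    (∀ ν : Fin d → ℕ, ν ≤ l →
      (∀ x ∈ HahnBox.box l, HahnBox.PhiDefined β ν (HahnBox.toReal x)) ∧
      ∃ P : MvPolynomial (Fin d) ℝ,
        (∀ x : Fin d → ℝ, HahnBox.PhiDefined β ν x →
          MvPolynomial.eval x P = HahnBox.phi β r l ν x) ∧
        ∀ x : Fin d → ℝ,
          HahnBox.diffOp β r l (fun y => MvPolynomial.eval y P) x =
            HahnBox.eigenval β r (∑ i, ν i) * MvPolynomial.eval x P) ∧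
    -- the orthogonality relation
    (∀ ν μ : Fin d → ℕ, ν ≤ l → μ ≤ l →
      ∑ x ∈ HahnBox.box l,
        HahnBox.phi β r l ν (HahnBox.toReal x) * HahnBox.phi β r l μ (HahnBox.toReal x) *
          HahnBox.weight β r l x =
        if ν = μ then HahnBox.normBCancelled β r l ν else 0) ∧
    -- the constant in its uncancelled form, wherever that form has no zero denominator
    (∀ ν : Fin d → ℕ, ν ≤ l → (∀ j, HahnBox.normDen β r l ν j ≠ 0) →
      HahnBox.normBCancelled β r l ν = HahnBox.normB β r l ν) := by
  have hA : HahnBox.Admissible β r (∑ i, l i) := by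
    rw [HahnBox.Admissible, Nat.cast_sum]; exact hβr
  have hr := hA.poch_r_ne_zero
  have hdef : ∀ ν ≤ l, ∀ x ∈ HahnBox.box l, HahnBox.PhiDefined β ν (HahnBox.toReal x) :=
    fun ν hν x hx => hA.phiDefined hν (Finset.mem_Iic.mp hx)
  refine ⟨fun ν hν => ⟨hdef ν hν, ?_⟩, fun ν μ hν hμ => ?_,
    fun ν hν h => HahnBox.normBCancelled_eq_normB hν h⟩
  · obtain ⟨P, hP⟩ := HahnBox.isPolyFun_phiReg β r l ν
    -- `P` represents `phiReg`, whose difference equation holds at every point, so no extension from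
    -- the domain of the quotient formula is needed.
    refine ⟨P, fun x hx => by rw [hP, HahnBox.phi_eq_phiReg hx], fun x => ?_⟩
    simp only [hP]
    exact HahnBox.diffOp_phiReg β r l ν hν x
  · have h := HahnBox.sum_phiReg_mul_phiReg β r l ν μ hν hμ
    rw [HahnBox.normBCancelled_eq hr hν]
    have h' : (if ν = μ then HahnBox.normReg β r l ν / HahnBox.poch r (∑ i, l i) else 0) =
        (if ν = μ then HahnBox.normReg β r l ν else 0) / HahnBox.poch r (∑ i, l i) := by
      split_ifs <;> simp
    rw [h', ← h, Finset.sum_div]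
    refine Finset.sum_congr rfl fun x hx => ?_
    rw [HahnBox.phi_eq_phiReg (hdef ν hν x hx), HahnBox.phi_eq_phiReg (hdef μ hμ x hx),
      HahnBox.weight_eq hr (Finset.mem_Iic.mp hx), mul_div_assoc]
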